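/- For a digraph $D$ and a set $X\subseteq V(D)$, the inversion of $X$ reverses the direction of all arcs of $D$ with both endvertices in $X$. A digraph is $k$-arc-strong if for every partition $(V_1,V_2)$ of its vertex set into two non-empty parts there are at least $k$ arcs with tail in $V_1$ and head in $V_2$. Let $\mathrm{sinv}'_k(D)$ be the minimum number of inversions that transform $D$ into a $k$-arc-strong digraph ($\infty$ if this is impossible), and let $$M'_k=\sup\{\mathrm{sinv}'_k(T) : T \text{ a finite tournament with at least } 2k+1 \text{ vertices}\}.$$ Then $M'_k\le \frac43 k+o(k)$ as $k\to\infty$. That is, there is a function $r:\mathbb N\to\mathbb R$ with $r(k)/k\to 0$ as $k\to\infty$ such that for all sufficiently large $k$, $M'_k$ is finite and $M'_k\le\frac43 k+r(k)$. Equivalently, for every $\varepsilon>0$ there is $k^*$ such that for every $k\ge k^*$, every finite tournament on at least $2k+1$ vertices can be made $k$-arc-strong with at most $(\frac43+\varepsilon)k$ inversions. -/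

import Mathlib

open Filter Asymptotics

namespace Digraph

/-- `D` is a tournament, i.e. an orientation of a complete graph: there are no loops, and any two
distinct vertices are joined by exactly one of the two possible arcs. -/
def IsTournament {V : Type*} (D : Digraph V) : Prop :=
  (∀ v, ¬ D.Adj v v) ∧ ∀ u v, u ≠ v → (D.Adj u v ∧ ¬ D.Adj v u) ∨ (D.Adj v u ∧ ¬ D.Adj u v)

/-- The inversion of the vertex set `X` in `D`: all arcs with both endvertices in `X` are
reversed, and the other arcs are kept. -/
def invert {V : Type*} (D : Digraph V) (X : Set V) : Digraph V where
  Adj u v := (u ∈ X ∧ v ∈ X ∧ D.Adj v u) ∨ (¬ (u ∈ X ∧ v ∈ X) ∧ D.Adj u v)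

/-- The digraph obtained from `D` by inverting the members of the family `L` one after another. -/
def invertFamily {V : Type*} (D : Digraph V) (L : List (Set V)) : Digraph V :=
  L.foldl invert D

/-- `D` is `k`-arc-strong: for every partition of the vertex set into two nonempty parts `S` and
`Sᶜ`, there are at least `k` arcs with tail in `S` and head in `Sᶜ`. -/
def IsArcStrong {V : Type*} (D : Digraph V) (k : ℕ) : Prop :=
  ∀ S : Set V, S.Nonempty → Sᶜ.Nonempty →
    (k : ℕ∞) ≤ {a : V × V | a.1 ∈ S ∧ a.2 ∈ Sᶜ ∧ D.Adj a.1 a.2}.encard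

/-- The `k`-arc-strong inversion number of `D`: the minimum number of inversions that transform
`D` into a `k`-arc-strong digraph (`⊤` if this is impossible). -/
noncomputable def arcStrongInvNumber {V : Type*} (D : Digraph V) (k : ℕ) : ℕ∞ :=
  ⨅ (L : List (Set V)) (_ : (D.invertFamily L).IsArcStrong k), (L.length : ℕ∞)

end Digraph

/-- The quantity `M'_k`: the maximum of the `k`-arc-strong inversion numbers of all (finite)
tournaments of order at least `2k + 1`, as a supremum in `ℕ∞` (`⊤` if they are unbounded). -/
noncomputable def maxArcStrongInvNumber (k : ℕ) : ℕ∞ :=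
  ⨆ (V : Type) (_ : Finite V) (T : Digraph V) (_ : T.IsTournament) (_ : 2 * k + 1 ≤ Nat.card V),
    T.arcStrongInvNumber k

/-!
For a tournament `D`, the sign of a pair `u, v` is `1` or `-1` according to the direction of the arc
between `u` and `v`; an inversion of `X` changes the signs of the pairs inside `X`. If each vertex
`v` gets a vector `x v` in `(ℤ/2) ^ t` and the sets `{v | x v i}`, `i < t`, are inverted, the sign
of `u, v` is multiplied by the Walsh character `(-1) ^ ⟨x u, x v⟩`. For random vectors,
orthogonality of the characters shows that the squared difference between out- and in-degree of a
vertex has small mean, so a bounded number of inversions makes all but a small fraction of the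
vertices of any large set nearly balanced (`Digraph.exists_almost_balanced`). A vertex outside the
set can be balanced against it as well, by a suitable choice of its own vector
(`Digraph.exists_sq_sum_mul_walsh_le`).

A tournament is `k`-arc-strong if each vertex has at least `k` out-neighbours and at least `k`
in-neighbours in a fixed set of at most `4k + 1` vertices
(`Digraph.IsTournament.isArcStrong_of_core`). If there are at least `5k / 2` vertices, such a core
is obtained directly from the almost balanced set, by a bounded number of inversions.

With fewer vertices, some set `W` of `2k + 1` vertices is to become regular exactly. Let `A ⊆ W` be
of even size and nearly balanced, with `B = W \ A` small but larger than the imbalances in `A`. Each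
vertex of `A` can then be given the number of out-neighbours in `B` that it needs, the arcs from `A`
can be spread evenly over `B`, and `B` itself can be made regular
(`Digraph.IsTournament.exists_regular_completion`). This changes only arcs incident to `B`; the
remaining vertices, fewer than `k / 2`, are joined to `W` in a prescribed way. All arcs at one
vertex can be prescribed by two inversions, of `insert b X` and of `X`, so twice the number of
vertices outside `A` suffices (`Digraph.IsTournament.exists_invertFamily_eq`). The total is less
than `4k / 3` for large `k`, hence the error term can be taken to be `0`.
-/

namespace Digraph

/-! ### Degrees, arc signs and arc-strength of tournaments -/

section Basics

open scoped Classical in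
/-- The number of arcs of `D` from `u` to the vertices of `S`. -/
noncomputable def outTo {V : Type*} (D : Digraph V) (u : V) (S : Finset V) : ℕ :=
  (S.filter fun v => D.Adj u v).card

open scoped Classical in
/-- The number of arcs of `D` from the vertices of `S` to `u`. -/
noncomputable def inFrom {V : Type*} (D : Digraph V) (u : V) (S : Finset V) : ℕ :=
  (S.filter fun v => D.Adj v u).card

open scoped Classical in
/-- The entry at `(u, v)` of the skew adjacency matrix of `D`: `1` for an arc from `u` to `v`, `-1`
for an arc from `v` to `u`, and `0` if there is no arc, or an arc in each direction. -/
noncomputable def arcSign {V : Type*} (D : Digraph V) (u v : V) : ℤ :=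
  (if D.Adj u v then 1 else 0) - (if D.Adj v u then 1 else 0)

/-- The digraph obtained from `D` by reversing all arcs. -/
def converse {V : Type*} (D : Digraph V) : Digraph V where
  Adj u v := D.Adj v u

variable {V : Type*} {D : Digraph V}

theorem IsTournament.adj_iff (h : D.IsTournament) {u v : V} (huv : u ≠ v) :
    D.Adj u v ↔ ¬ D.Adj v u := by
  rcases h.2 u v huv with h | h <;> tauto

theorem isTournament_of_adj_iff (h₁ : ∀ v, ¬ D.Adj v v)
    (h₂ : ∀ u v, u ≠ v → (D.Adj u v ↔ ¬ D.Adj v u)) : D.IsTournament :=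
  ⟨h₁, fun u v huv => by have := h₂ u v huv; tauto⟩

theorem IsTournament.converse (h : D.IsTournament) : D.converse.IsTournament :=
  isTournament_of_adj_iff h.1 fun _ _ huv => h.adj_iff huv.symm

theorem IsTournament.invert (h : D.IsTournament) (X : Set V) : (D.invert X).IsTournament := by
  refine isTournament_of_adj_iff (fun v => ?_) fun u v huv => ?_
  · have := h.1 v
    simp only [Digraph.invert]
    tauto
  · have := h.adj_iff huv
    simp only [Digraph.invert]
    tauto

theorem IsTournament.invertFamily (h : D.IsTournament) (L : List (Set V)) :
    (D.invertFamily L).IsTournament := by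
  induction L generalizing D with
  | nil => exact h
  | cons X L ih => exact ih (h.invert X)

theorem invertFamily_append (D : Digraph V) (L L' : List (Set V)) :
    D.invertFamily (L ++ L') = (D.invertFamily L).invertFamily L' := by
  simp [invertFamily, List.foldl_append]

open scoped Classical in
theorem arcSign_invert (D : Digraph V) (X : Set V) (u v : V) :
    (D.invert X).arcSign u v = D.arcSign u v * (if u ∈ X ∧ v ∈ X then -1 else 1) := by
  unfold arcSign Digraph.invert
  by_cases hu : u ∈ X <;> by_cases hv : v ∈ X <;> simp [hu, hv]

open scoped Classical in
theorem arcSign_invertFamily (D : Digraph V) (L : List (Set V)) (u v : V) :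
    (D.invertFamily L).arcSign u v =
      D.arcSign u v * (L.map fun X => if u ∈ X ∧ v ∈ X then (-1 : ℤ) else 1).prod := by
  induction L generalizing D with
  | nil => simp [invertFamily]
  | cons X L ih =>
    have := ih (D.invert X)
    rw [arcSign_invert] at this
    rw [List.map_cons, List.prod_cons, ← mul_assoc]
    exact this

theorem arcSign_self (D : Digraph V) (u : V) : D.arcSign u u = 0 := by simp [arcSign]

theorem arcSign_swap (D : Digraph V) (u v : V) : D.arcSign u v = - D.arcSign v u := by
  simp [arcSign]

theorem abs_arcSign_le (D : Digraph V) (u v : V) : |D.arcSign u v| ≤ 1 := by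
  unfold arcSign
  split_ifs <;> simp

theorem sum_arcSign (D : Digraph V) (u : V) (S : Finset V) :
    ∑ v ∈ S, D.arcSign u v = (D.outTo u S : ℤ) - D.inFrom u S := by
  classical
  simp [arcSign, outTo, inFrom, Finset.sum_sub_distrib, Finset.sum_boole]

/-- Changing a finite set by few elements changes the sum of the arc signs by little. -/
theorem abs_sum_arcSign_le_of_subset [DecidableEq V] (D : Digraph V) (u : V) {S S' : Finset V}
    (h : S ⊆ S') :
    |∑ v ∈ S, D.arcSign u v| ≤ |∑ v ∈ S', D.arcSign u v| + (S' \ S).card := by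
  have h₁ := Finset.sum_sdiff (f := fun v => D.arcSign u v) h
  have h₂ : |∑ v ∈ S' \ S, D.arcSign u v| ≤ (S' \ S).card := by
    refine (Finset.abs_sum_le_sum_abs _ _).trans ?_
    refine (Finset.sum_le_sum fun v _ => D.abs_arcSign_le u v).trans ?_
    simp
  have h₃ : ∑ v ∈ S, D.arcSign u v
      = ∑ v ∈ S', D.arcSign u v - ∑ v ∈ S' \ S, D.arcSign u v := by linarith
  rw [h₃]
  exact (abs_sub _ _).trans (by linarith)

theorem IsTournament.outTo_add_inFrom_of_notMem (h : D.IsTournament) {u : V} {S : Finset V}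
    (hu : u ∉ S) : D.outTo u S + D.inFrom u S = S.card := by
  classical
  have : S.filter (fun v => D.Adj v u) = S.filter (fun v => ¬ D.Adj u v) := by
    refine Finset.filter_congr fun v hv => h.adj_iff ?_
    rintro rfl
    exact hu hv
  rw [outTo, inFrom, this, Finset.card_filter_add_card_filter_not]

theorem IsTournament.outTo_add_inFrom_of_mem (h : D.IsTournament) {u : V} {S : Finset V}
    (hu : u ∈ S) : D.outTo u S + D.inFrom u S + 1 = S.card := by
  classical
  have h₁ : ∀ E : Digraph V, ¬ E.Adj u u → E.outTo u (S.erase u) = E.outTo u S := by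
    intro E hE
    rw [outTo, outTo, Finset.filter_erase, Finset.erase_eq_of_notMem]
    simp [hE]
  have h₂ := h.outTo_add_inFrom_of_notMem (Finset.notMem_erase u S)
  have h₃ : D.inFrom u (S.erase u) = D.inFrom u S := h₁ D.converse (h.1 u)
  rw [h₁ D (h.1 u), h₃] at h₂
  rw [h₂]
  exact Finset.card_erase_add_one hu

theorem sum_sum_arcSign_eq_zero (D : Digraph V) (S : Finset V) :
    ∑ u ∈ S, ∑ v ∈ S, D.arcSign u v = 0 := by
  have h : ∑ u ∈ S, ∑ v ∈ S, D.arcSign u v = - ∑ u ∈ S, ∑ v ∈ S, D.arcSign u v := by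
    conv_lhs => rw [Finset.sum_comm]
    simp only [← Finset.sum_neg_distrib]
    exact Finset.sum_congr rfl fun u _ => Finset.sum_congr rfl fun v _ => D.arcSign_swap v u
  linarith

theorem IsTournament.two_mul_sum_outTo (h : D.IsTournament) (S : Finset V) :
    2 * ∑ u ∈ S, (D.outTo u S : ℤ) = S.card * (S.card - 1) := by
  have h₁ := D.sum_sum_arcSign_eq_zero S
  have h₂ : ∀ u ∈ S, 2 * (D.outTo u S : ℤ) = (S.card - 1) + ∑ v ∈ S, D.arcSign u v := by
    intro u hu
    have := h.outTo_add_inFrom_of_mem hu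
    rw [sum_arcSign]
    have : (D.outTo u S : ℤ) + D.inFrom u S + 1 = S.card := by exact_mod_cast this
    linarith
  rw [Finset.mul_sum, Finset.sum_congr rfl h₂, Finset.sum_add_distrib, h₁,
    Finset.sum_const, nsmul_eq_mul, add_zero]

theorem outTo_sdiff_add [DecidableEq V] (D : Digraph V) (u : V) {S W : Finset V} (h : S ⊆ W) :
    D.outTo u (W \ S) + D.outTo u S = D.outTo u W := by
  classical
  rw [outTo, outTo, outTo, ← Finset.card_union_of_disjoint, ← Finset.filter_union,
    Finset.sdiff_union_of_subset h]
  exact Finset.disjoint_filter_filter Finset.sdiff_disjoint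

theorem outTo_union [DecidableEq V] (D : Digraph V) (u : V) {S W : Finset V} (h : Disjoint S W) :
    D.outTo u (S ∪ W) = D.outTo u S + D.outTo u W := by
  classical
  rw [outTo, outTo, outTo, Finset.filter_union, Finset.card_union_of_disjoint]
  exact Finset.disjoint_filter_filter h

/-- If the out-degrees in `W` are at least `k`, then at least `k` arcs leave each set of at most
`2k` vertices of `W`: of the `s k` arcs or more that start in such a set of size `s`, only
`s (s - 1) / 2` stay in it. -/
theorem IsTournament.le_sum_outTo_sdiff [DecidableEq V] (h : D.IsTournament) {k : ℕ}
    {S W : Finset V} (hSW : S ⊆ W) (hS : 1 ≤ S.card) (hS' : S.card ≤ 2 * k)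
    (hW : ∀ u ∈ S, k ≤ D.outTo u W) : k ≤ ∑ u ∈ S, D.outTo u (W \ S) := by
  have h₁ := h.two_mul_sum_outTo S
  have h₂ : ∑ u ∈ S, D.outTo u (W \ S) + ∑ u ∈ S, D.outTo u S = ∑ u ∈ S, D.outTo u W := by
    rw [← Finset.sum_add_distrib]
    exact Finset.sum_congr rfl fun u _ => D.outTo_sdiff_add u hSW
  have h₃ : S.card * k ≤ ∑ u ∈ S, D.outTo u W := by
    rw [← smul_eq_mul, ← Finset.sum_const]
    exact Finset.sum_le_sum hW
  zify at h₂ h₃ hS hS' ⊢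
  nlinarith [mul_nonneg (sub_nonneg.2 hS) (sub_nonneg.2 hS')]

open scoped Classical in
theorem sum_outTo_eq_card (D : Digraph V) (S S' : Finset V) :
    ∑ u ∈ S, D.outTo u S' = ((S ×ˢ S').filter fun a => D.Adj a.1 a.2).card := by
  rw [Finset.card_filter, Finset.sum_product]
  exact Finset.sum_congr rfl fun u _ => by rw [outTo, Finset.card_filter]

open scoped Classical in
theorem sum_inFrom_eq_card (D : Digraph V) (S S' : Finset V) :
    ∑ v ∈ S', D.inFrom v S = ((S ×ˢ S').filter fun a => D.Adj a.1 a.2).card := by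
  rw [Finset.card_filter, Finset.sum_product_right]
  exact Finset.sum_congr rfl fun u _ => by rw [inFrom, Finset.card_filter]

/-- A tournament is `k`-arc-strong if it has a core `W` of at most `4k + 1` vertices such that every
vertex sends at least `k` arcs to `W` and receives at least `k` arcs from `W`. -/
theorem IsTournament.isArcStrong_of_core (h : D.IsTournament) {k : ℕ} {W : Finset V}
    (hcard : W.card ≤ 4 * k + 1) (hout : ∀ v, k ≤ D.outTo v W) (hin : ∀ v, k ≤ D.inFrom v W) :
    D.IsArcStrong k := by
  classical
  intro S hS hS'
  suffices H : ∃ P Q : Finset V, (∀ u ∈ P, u ∈ S) ∧ (∀ v ∈ Q, v ∉ S) ∧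
      k ≤ ((P ×ˢ Q).filter fun a => D.Adj a.1 a.2).card by
    obtain ⟨P, Q, hP, hQ, hk⟩ := H
    have : (k : ℕ∞) ≤ (((P ×ˢ Q).filter fun a => D.Adj a.1 a.2 : Finset (V × V)) :
        Set (V × V)).encard := by
      rw [Set.encard_coe_eq_coe_finsetCard]
      exact_mod_cast hk
    refine this.trans (Set.encard_le_encard ?_)
    intro a ha
    simp only [Finset.coe_filter, Finset.mem_product, Set.mem_ofPred_eq] at ha
    exact ⟨hP _ ha.1.1, hQ _ ha.1.2, ha.2⟩
  set P := W.filter (· ∈ S) with hPdef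
  set Q := W.filter (· ∉ S) with hQdef
  have hWP : W \ P = Q := by
    ext; simp only [hPdef, hQdef, Finset.mem_sdiff, Finset.mem_filter]; tauto
  have hWQ : W \ Q = P := by
    ext; simp only [hPdef, hQdef, Finset.mem_sdiff, Finset.mem_filter]; tauto
  have hPS : ∀ u ∈ P, u ∈ S := fun u hu => (Finset.mem_filter.1 hu).2
  have hQS : ∀ u ∈ Q, u ∉ S := fun u hu => (Finset.mem_filter.1 hu).2
  rcases P.eq_empty_or_nonempty with hP | hP
  · obtain ⟨v, hv⟩ := hS
    refine ⟨{v}, W, by simpa using hv, fun u hu huS => ?_, ?_⟩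
    · have : u ∈ P := Finset.mem_filter.2 ⟨hu, huS⟩
      simp [hP] at this
    · rw [← sum_outTo_eq_card, Finset.sum_singleton]
      exact hout v
  rcases Q.eq_empty_or_nonempty with hQ | hQ
  · obtain ⟨v, hv⟩ := hS'
    refine ⟨W, {v}, fun u hu => ?_, by simpa using hv, ?_⟩
    · by_contra huS
      have : u ∈ Q := Finset.mem_filter.2 ⟨hu, huS⟩
      simp [hQ] at this
    · rw [← sum_inFrom_eq_card, Finset.sum_singleton]
      exact hin v
  refine ⟨P, Q, hPS, hQS, ?_⟩
  have hPQ : P.card + Q.card = W.card := Finset.card_filter_add_card_filter_not _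
  by_cases hP2 : P.card ≤ 2 * k
  · rw [← sum_outTo_eq_card, ← hWP]
    exact h.le_sum_outTo_sdiff (Finset.filter_subset _ _) hP.card_pos hP2 fun u _ => hout u
  · rw [← sum_inFrom_eq_card, ← hWQ]
    exact h.converse.le_sum_outTo_sdiff (Finset.filter_subset _ _) hQ.card_pos (by omega)
      fun u _ => hin u

end Basics

/-! ### Balanced Walsh signs -/

section Averaging

/-- The Walsh character of `(ℤ/2)^ι`: the sign `(-1) ^ #{i | y i ∧ z i}`. -/
def walsh {ι : Type*} [Fintype ι] (y z : ι → Bool) : ℤ :=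
  ∏ i, if y i && z i then -1 else 1

variable {ι : Type*} [Fintype ι]

theorem sum_walsh_mul_walsh [DecidableEq ι] (z z' : ι → Bool) :
    ∑ y : ι → Bool, walsh y z * walsh y z' =
      if z = z' then (Fintype.card (ι → Bool) : ℤ) else 0 := by
  have h₁ : ∀ y : ι → Bool, walsh y z * walsh y z' =
      ∏ i, (if y i && z i then -1 else 1) * (if y i && z' i then -1 else 1 : ℤ) :=
    fun y => Finset.prod_mul_distrib.symm
  have h₂ := Finset.prod_univ_sum (fun _ : ι => (Finset.univ : Finset Bool))
    (fun i b => (if b && z i then -1 else 1) * (if b && z' i then -1 else 1 : ℤ))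
  rw [Fintype.piFinset_univ] at h₂
  simp only [h₁]
  rw [← h₂]
  have h₃ : ∀ i, ∑ b : Bool, (if b && z i then -1 else 1) * (if b && z' i then -1 else 1 : ℤ) =
      if z i = z' i then 2 else 0 := by
    intro i
    cases z i <;> cases z' i <;> simp
  simp only [h₃]
  split_ifs with h
  · subst h
    simp
  · obtain ⟨i, hi⟩ := Function.ne_iff.1 h
    exact Finset.prod_eq_zero (Finset.mem_univ i) (by simp [hi])

/-- The mean over `y` of the square of `∑ v, s v * walsh y (x v)` is a sum over the pairs `v, w`
with `x v = x w`. -/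
theorem sum_sq_sum_mul_walsh [DecidableEq ι] {V : Type*} (S : Finset V) (s : V → ℤ)
    (x : V → ι → Bool) :
    ∑ y : ι → Bool, (∑ v ∈ S, s v * walsh y (x v)) ^ 2 =
      Fintype.card (ι → Bool) * ∑ v ∈ S, ∑ w ∈ S, if x v = x w then s v * s w else 0 := by
  have h₁ : ∀ y : ι → Bool, (∑ v ∈ S, s v * walsh y (x v)) ^ 2 =
      ∑ v ∈ S, ∑ w ∈ S, s v * s w * (walsh y (x v) * walsh y (x w)) := by
    intro y
    rw [sq, Finset.sum_mul_sum]
    exact Finset.sum_congr rfl fun v _ => Finset.sum_congr rfl fun w _ => by ring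
  simp only [h₁]
  rw [Finset.sum_comm, Finset.mul_sum]
  refine Finset.sum_congr rfl fun v _ => ?_
  rw [Finset.sum_comm, Finset.mul_sum]
  refine Finset.sum_congr rfl fun w _ => ?_
  rw [← Finset.mul_sum, sum_walsh_mul_walsh]
  split_ifs <;> ring

/-- The number of ordered pairs of elements of `S` that have the same label. -/
def collisions {V E : Type*} [DecidableEq E] (S : Finset V) (x : V → E) : ℤ :=
  ∑ v ∈ S, ∑ w ∈ S, if x v = x w then 1 else 0

theorem collisions_mono {V E : Type*} [DecidableEq E] {S S' : Finset V} (h : S ⊆ S')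
    (x : V → E) : collisions S x ≤ collisions S' x := by
  unfold collisions
  refine (Finset.sum_le_sum fun v _ => Finset.sum_le_sum_of_subset_of_nonneg h ?_).trans
    (Finset.sum_le_sum_of_subset_of_nonneg h ?_)
  · intros; split_ifs <;> simp
  · intros; exact Finset.sum_nonneg fun _ _ => by split_ifs <;> simp

theorem sum_sq_sum_mul_walsh_le [DecidableEq ι] {V : Type*} (S : Finset V) (s : V → ℤ)
    (hs : ∀ v, |s v| ≤ 1) (x : V → ι → Bool) :
    ∑ y : ι → Bool, (∑ v ∈ S, s v * walsh y (x v)) ^ 2 ≤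
      Fintype.card (ι → Bool) * collisions S x := by
  rw [sum_sq_sum_mul_walsh]
  refine mul_le_mul_of_nonneg_left ?_ (by positivity)
  refine Finset.sum_le_sum fun v _ => Finset.sum_le_sum fun w _ => ?_
  split_ifs
  · refine (le_abs_self _).trans ?_
    rw [abs_mul]
    exact mul_le_one₀ (hs v) (abs_nonneg _) (hs w)
  · exact le_rfl

/-- A vertex whose label is still free can be balanced against `S`. -/
theorem exists_sq_sum_mul_walsh_le [DecidableEq ι] {V : Type*} (S : Finset V) (s : V → ℤ)
    (hs : ∀ v, |s v| ≤ 1) (x : V → ι → Bool) :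
    ∃ y : ι → Bool, (∑ v ∈ S, s v * walsh y (x v)) ^ 2 ≤ collisions S x := by
  by_contra! hlt
  have h₁ := sum_sq_sum_mul_walsh_le S s hs x
  have h₂ : ∑ _y : ι → Bool, collisions S x <
      ∑ y : ι → Bool, (∑ v ∈ S, s v * walsh y (x v)) ^ 2 :=
    Finset.sum_lt_sum_of_nonempty Finset.univ_nonempty fun y _ => hlt y
  rw [Finset.sum_const, Finset.card_univ, nsmul_eq_mul] at h₂
  linarith

/-- Resampling one coordinate of a uniformly random function does not change expectations. -/
theorem sum_sum_update {V E : Type*} [Fintype V] [DecidableEq V] [Fintype E] [DecidableEq E]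
    (F : (V → E) → ℤ) (u : V) :
    ∑ x : V → E, ∑ y : E, F (Function.update x u y) = Fintype.card E * ∑ x : V → E, F x := by
  have h₁ : ∑ p : (V → E) × E, F (Function.update p.1 u p.2) = ∑ p : (V → E) × E, F p.1 := by
    let e : (V → E) × E → (V → E) × E := fun p => (Function.update p.1 u p.2, p.1 u)
    have he : Function.Involutive e := by
      intro p
      simp [e]
    exact Equiv.sum_comp he.toPerm fun p => F p.1
  rw [Fintype.sum_prod_type, Fintype.sum_prod_type] at h₁
  rw [h₁, Finset.mul_sum]
  refine Finset.sum_congr rfl fun x _ => ?_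
  simp

theorem card_mul_sum_ite_eq {V E : Type*} [Fintype V] [DecidableEq V] [Fintype E]
    [DecidableEq E] {v w : V} (h : v ≠ w) :
    (Fintype.card E : ℤ) * ∑ x : V → E, (if x v = x w then (1 : ℤ) else 0) =
      Fintype.card (V → E) := by
  rw [← sum_sum_update _ v]
  simp [Function.update_of_ne h.symm]

theorem card_mul_sum_collisions_le {V E : Type*} [Fintype V] [DecidableEq V] [Fintype E]
    [DecidableEq E] (S : Finset V) :
    (Fintype.card E : ℤ) * ∑ x : V → E, collisions S x ≤
      Fintype.card (V → E) * (Fintype.card E * S.card + S.card ^ 2) := by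
  have h₁ : ∀ v w : V, (Fintype.card E : ℤ) * ∑ x : V → E, (if x v = x w then (1 : ℤ) else 0) ≤
      Fintype.card (V → E) * (1 + if v = w then (Fintype.card E : ℤ) else 0) := by
    intro v w
    by_cases h : v = w
    · subst h
      simp only [if_true, Finset.sum_const, Finset.card_univ, nsmul_eq_mul]
      nlinarith [Nat.cast_nonneg (α := ℤ) (Fintype.card (V → E))]
    · rw [card_mul_sum_ite_eq h]
      simp [h]
  have h₂ : ∑ x : V → E, collisions S x =
      ∑ v ∈ S, ∑ w ∈ S, ∑ x : V → E, (if x v = x w then (1 : ℤ) else 0) := by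
    unfold collisions
    rw [Finset.sum_comm]
    exact Finset.sum_congr rfl fun v _ => Finset.sum_comm
  rw [h₂, Finset.mul_sum]
  simp only [Finset.mul_sum (s := S)]
  refine (Finset.sum_le_sum fun v _ => Finset.sum_le_sum fun w _ => h₁ v w).trans ?_
  refine le_of_eq ?_
  simp only [← Finset.mul_sum, Finset.sum_add_distrib]
  congr 1
  simp only [Finset.sum_const, nsmul_eq_mul, mul_one, Finset.sum_ite_eq]
  rw [Finset.sum_congr rfl (g := fun _ => (Fintype.card E : ℤ)) fun v hv => by simp [hv]]
  rw [Finset.sum_const, nsmul_eq_mul]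
  ring

/-- Vectors `x v` exist whose Walsh signs balance the rows of a bounded matrix with zero diagonal
in quadratic mean, while few pairs `v, w` have `x v = x w`. The left-hand side is averaged over all
`x`; for the square of a row, the average over the vector of that row is taken first. -/
theorem exists_walsh_balanced [DecidableEq ι] {V : Type*} [Fintype V] [DecidableEq V]
    (S : Finset V) (s : V → V → ℤ) (hs : ∀ u v, |s u v| ≤ 1) (hs₀ : ∀ u, s u u = 0) :
    ∃ x : V → ι → Bool, (Fintype.card (ι → Bool) : ℤ) *
      (∑ u ∈ S, (∑ v ∈ S, s u v * walsh (x u) (x v)) ^ 2 + S.card * collisions S x) ≤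
        2 * S.card * (Fintype.card (ι → Bool) * S.card + S.card ^ 2) := by
  set q : ℤ := (Fintype.card (ι → Bool) : ℤ) with hq
  have hq0 : 0 < q := by rw [hq]; exact_mod_cast Fintype.card_pos
  set R : (V → ι → Bool) → V → ℤ := fun x u => (∑ v ∈ S, s u v * walsh (x u) (x v)) ^ 2 with hR
  have hrow : ∀ u, ∑ x, R x u ≤ ∑ x : V → ι → Bool, collisions S x := by
    intro u
    have h₁ : q * ∑ x, R x u ≤ q * ∑ x : V → ι → Bool, collisions S x := by
      rw [← sum_sum_update (fun x => R x u) u, Finset.mul_sum]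
      refine Finset.sum_le_sum fun x _ => ?_
      refine le_trans (le_of_eq ?_) (sum_sq_sum_mul_walsh_le S (s u) (hs u) x)
      refine Finset.sum_congr rfl fun y _ => ?_
      simp only [hR]
      congr 1
      refine Finset.sum_congr rfl fun v _ => ?_
      by_cases hv : v = u
      · subst hv
        simp [hs₀]
      · simp [Function.update_of_ne hv]
    exact le_of_mul_le_mul_left h₁ hq0
  by_contra! hlt
  have h₁ := Finset.sum_lt_sum_of_nonempty (s := (Finset.univ : Finset (V → ι → Bool)))
    Finset.univ_nonempty fun x _ => hlt x
  rw [Finset.sum_const, Finset.card_univ, nsmul_eq_mul, ← Finset.mul_sum,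
    Finset.sum_add_distrib, ← Finset.mul_sum, Finset.sum_comm] at h₁
  have h₂ : ∑ u ∈ S, ∑ x, R x u ≤ S.card * ∑ x : V → ι → Bool, collisions S x := by
    rw [← nsmul_eq_mul, ← Finset.sum_const]
    exact Finset.sum_le_sum fun u _ => hrow u
  have h₃ := card_mul_sum_collisions_le (E := ι → Bool) S
  have h₄ : (0 : ℤ) ≤ S.card := by positivity
  nlinarith [mul_le_mul_of_nonneg_left h₃ h₄, mul_le_mul_of_nonneg_left h₂ hq0.le]

/-- `exists_walsh_balanced` with `2 ^ 20` labels and numerical constants. -/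
theorem exists_almost_balanced {V : Type*} [Fintype V] [DecidableEq V]
    (S : Finset V) (hS : 1000000 ≤ S.card) (s : V → V → ℤ) (hs : ∀ u v, |s u v| ≤ 1)
    (hs₀ : ∀ u, s u u = 0) :
    ∃ (x : V → Fin 20 → Bool) (G : Finset V), G ⊆ S ∧ 50 * (S \ G).card ≤ S.card ∧
      (∀ u ∈ G, 50 * |∑ v ∈ S, s u v * walsh (x u) (x v)| ≤ S.card) ∧
      2500 * collisions S x ≤ (S.card : ℤ) ^ 2 := by
  obtain ⟨x, hx⟩ := exists_walsh_balanced (ι := Fin 20) S s hs hs₀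
  have hq : (Fintype.card (Fin 20 → Bool) : ℤ) = 1048576 := by simp
  rw [hq] at hx
  set m : ℤ := (S.card : ℤ) with hm
  have hm' : (1000000 : ℤ) ≤ m := by rw [hm]; exact_mod_cast hS
  set r : V → ℤ := fun u => ∑ v ∈ S, s u v * walsh (x u) (x v) with hr
  have hC : 0 ≤ collisions S x :=
    Finset.sum_nonneg fun _ _ => Finset.sum_nonneg fun _ _ => by split_ifs <;> simp
  have hR : 0 ≤ ∑ u ∈ S, (r u) ^ 2 := Finset.sum_nonneg fun _ _ => sq_nonneg _
  refine ⟨x, S.filter fun u => 50 * |r u| ≤ m, Finset.filter_subset _ _, ?_,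
    fun u hu => (Finset.mem_filter.1 hu).2, ?_⟩
  · rw [← Finset.filter_not]
    set B := S.filter fun u => ¬ 50 * |r u| ≤ m with hB
    have h₁ : (B.card : ℤ) * m ^ 2 ≤ 2500 * ∑ u ∈ S, (r u) ^ 2 := by
      rw [Finset.mul_sum, ← nsmul_eq_mul, ← Finset.sum_const]
      refine (Finset.sum_le_sum fun u hu => ?_).trans
        (Finset.sum_le_sum_of_subset_of_nonneg (Finset.filter_subset _ S)
          fun u _ _ => mul_nonneg (by norm_num) (sq_nonneg (r u)))
      have h₂ := (Finset.mem_filter.1 hu).2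
      have h₃ := sq_abs (r u)
      nlinarith [abs_nonneg (r u)]
    have h₂ : 1048576 * ∑ u ∈ S, (r u) ^ 2 ≤ m ^ 2 * (2 * (1048576 + m)) := by
      nlinarith [mul_nonneg (by linarith : (0 : ℤ) ≤ m) hC]
    have h₃ : m ^ 2 * (1048576 * (B.card : ℤ)) ≤ m ^ 2 * (5000 * (1048576 + m)) := by linarith
    have h₄ := le_of_mul_le_mul_left h₃ (by positivity)
    have h₅ : 50 * (B.card : ℤ) ≤ m := by linarith
    rw [hm] at h₅
    exact_mod_cast h₅
  · have h₁ : m * (1048576 * collisions S x) ≤ m * (2 * m * (1048576 + m)) := by nlinarith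
    have h₂ := le_of_mul_le_mul_left h₁ (by linarith)
    nlinarith

end Averaging

/-! ### Realizing changes by inversions -/

section Realization

variable {V : Type*} {D : Digraph V}

/-- Inverting the sets `{v | x v i}` multiplies the sign of the pair `u, v` by `walsh (x u) (x v)`.
-/
theorem exists_invertFamily_arcSign (D : Digraph V) {t : ℕ} (x : V → Fin t → Bool) :
    ∃ L : List (Set V), L.length = t ∧
      ∀ u v, (D.invertFamily L).arcSign u v = D.arcSign u v * walsh (x u) (x v) := by
  classical
  refine ⟨List.ofFn fun i => {v | x v i = true}, List.length_ofFn, fun u v => ?_⟩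
  rw [arcSign_invertFamily, List.map_ofFn, List.prod_ofFn]
  congr 1
  refine Finset.prod_congr rfl fun i _ => ?_
  simp

open scoped Classical in
/-- Inverting `insert b X` and then `X`, where `b ∉ X`, reverses the arcs between `b` and `X` and
no others. -/
theorem invert_insert_invert_adj (D : Digraph V) {b : V} {X : Set V} (hb : b ∉ X) (u v : V) :
    ((D.invert (insert b X)).invert X).Adj u v ↔
      if (u = b ∧ v ∈ X) ∨ (v = b ∧ u ∈ X) then D.Adj v u else D.Adj u v := by
  simp only [Digraph.invert, Set.mem_insert_iff]
  by_cases hu : u ∈ X <;> by_cases hv : v ∈ X <;> by_cases hub : u = b <;> by_cases hvb : v = b <;>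
    simp_all

/-- Two tournaments that agree outside a set `B` of vertices differ by at most `2 |B|` inversions:
two for each vertex of `B`. -/
theorem IsTournament.exists_invertFamily_eq (hD : D.IsTournament) {R : Digraph V}
    (hR : R.IsTournament) (B : Finset V)
    (h : ∀ u v, u ∉ B → v ∉ B → (D.Adj u v ↔ R.Adj u v)) :
    ∃ L : List (Set V), L.length ≤ 2 * B.card ∧ D.invertFamily L = R := by
  classical
  induction B using Finset.induction_on generalizing D with
  | empty =>
    refine ⟨[], by simp, ?_⟩
    ext u v
    exact h u v (Finset.notMem_empty u) (Finset.notMem_empty v)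
  | insert b B hb ih =>
    set X : Set V := {v | v ≠ b ∧ ¬ (D.Adj b v ↔ R.Adj b v)} with hX
    have hbX : b ∉ X := fun hb => hb.1 rfl
    obtain ⟨L, hL, hLR⟩ := ih (D := (D.invert (insert b X)).invert X) ((hD.invert _).invert _) (by
      intro u v hu hv
      rw [invert_insert_invert_adj D hbX]
      have h₁ : ∀ w, w ∈ X ↔ w ≠ b ∧ ¬ (D.Adj b w ↔ R.Adj b w) := fun w => Iff.rfl
      have h₂ : ∀ w, w ≠ b → (D.Adj b w ↔ ¬ D.Adj w b) := fun w hw => hD.adj_iff hw.symm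
      have h₃ : ∀ w, w ≠ b → (R.Adj b w ↔ ¬ R.Adj w b) := fun w hw => hR.adj_iff hw.symm
      by_cases hub : u = b
      · subst hub
        by_cases hvu : v = u
        · subst hvu
          simp [hbX, hD.1, hR.1]
        · have := h₁ v
          have := h₂ v hvu
          have := h₃ v hvu
          by_cases hvX : v ∈ X <;> simp only [hvX, hvu] <;> simp <;> tauto
      · by_cases hvb : v = b
        · subst hvb
          have := h₁ u
          have := h₂ u hub
          have := h₃ u hub
          by_cases huX : u ∈ X <;> simp only [huX, hub] <;> simp <;> tauto
        · simp only [hub, hvb, false_and, or_self, if_false]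
          exact h u v (by simp [hub, hu]) (by simp [hvb, hv]))
    refine ⟨insert b X :: X :: L, ?_, hLR⟩
    rw [Finset.card_insert_of_notMem hb]
    simp only [List.length_cons]
    omega

end Realization

/-! ### Balanced set families and regular tournaments -/

section Completion

/-- Subsets of `B` of prescribed sizes can be chosen so that any two elements of `B` are covered
equally often, up to one. -/
theorem exists_subsets_balanced {V : Type*} [DecidableEq V] (A B : Finset V) (f : V → ℕ)
    (hf : ∀ v ∈ A, f v ≤ B.card) :
    ∃ N : V → Finset V, (∀ v ∈ A, N v ⊆ B ∧ (N v).card = f v) ∧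
      ∃ q, ∀ u ∈ B, q ≤ (A.filter fun v => u ∈ N v).card ∧
        (A.filter fun v => u ∈ N v).card ≤ q + 1 := by
  induction A using Finset.induction_on with
  | empty => exact ⟨fun _ => ∅, by simp, 0, by simp⟩
  | insert a A ha ih =>
    obtain ⟨N, hN, q, hq⟩ := ih fun v hv => hf v (Finset.mem_insert_of_mem hv)
    set c : V → ℕ := fun u => (A.filter fun v => u ∈ N v).card with hc
    -- the new set takes elements that have been covered only `q` times before any others
    set B₀ := B.filter fun u => c u = q with hB₀
    have hB₀B : B₀ ⊆ B := Finset.filter_subset _ _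
    obtain ⟨M, hMB, hMcard, hM⟩ : ∃ M ⊆ B, M.card = f a ∧ (M ⊆ B₀ ∨ B₀ ⊆ M) := by
      by_cases h : f a ≤ B₀.card
      · obtain ⟨M, hM, hMc⟩ := Finset.exists_subset_card_eq h
        exact ⟨M, hM.trans hB₀B, hMc, Or.inl hM⟩
      · obtain ⟨M, hM, hMB, hMc⟩ := Finset.exists_subsuperset_card_eq hB₀B (not_le.1 h).le
          (hf a (Finset.mem_insert_self a A))
        exact ⟨M, hMB, hMc, Or.inr hM⟩
    have hne : ∀ v ∈ A, v ≠ a := fun v hv hva => ha (hva ▸ hv)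
    refine ⟨Function.update N a M, ?_, ?_⟩
    · intro v hv
      rcases Finset.mem_insert.1 hv with rfl | hv
      · simpa using ⟨hMB, hMcard⟩
      · rw [Function.update_of_ne (hne v hv)]
        exact hN v hv
    · have hcount : ∀ u, ((insert a A).filter fun v => u ∈ Function.update N a M v).card =
          c u + if u ∈ M then 1 else 0 := by
        intro u
        have h₁ : A.filter (fun v => u ∈ Function.update N a M v) =
            A.filter fun v => u ∈ N v :=
          Finset.filter_congr fun v hv => by rw [Function.update_of_ne (hne v hv)]
        rw [Finset.filter_insert, Function.update_self, h₁]
        split_ifs with h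
        · rw [Finset.card_insert_of_notMem]
          simp [ha]
        · rfl
      have hB₀' : ∀ u ∈ B, (u ∈ B₀ ↔ c u = q) := fun u hu => by simp [hB₀, hu]
      rcases hM with hM | hM
      · refine ⟨q, fun u hu => ?_⟩
        rw [hcount]
        have h₁ := hq u hu
        have h₂ := hB₀' u hu
        have h₃ := @hM u
        split_ifs with h
        · have := h₂.1 (h₃ h)
          omega
        · exact ⟨h₁.1, h₁.2⟩
      · refine ⟨q + 1, fun u hu => ?_⟩
        rw [hcount]
        have h₁ : q ≤ c u ∧ c u ≤ q + 1 := hq u hu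
        have h₂ := hB₀' u hu
        have h₃ := @hM u
        split_ifs with h
        · omega
        · have : c u ≠ q := fun hcu => h (h₃ (h₂.2 hcu))
          omega

/-- There is a tournament of each odd order `2c + 1` with all out-degrees equal to `c`: in the
circulant tournament on `ℤ/(2c+1)`, a vertex dominates the next `c` vertices. -/
theorem exists_regular_tournament {V : Type*} (B : Finset V) {c : ℕ}
    (hB : B.card = 2 * c + 1) : ∃ C : Digraph V, (∀ v, ¬ C.Adj v v) ∧
      (∀ u ∈ B, ∀ v ∈ B, u ≠ v → (C.Adj u v ↔ ¬ C.Adj v u)) ∧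
      ∀ v ∈ B, C.outTo v B = c := by
  classical
  have e : B ≃ ZMod (2 * c + 1) := Fintype.equivOfCardEq (by
    rw [Fintype.card_coe, hB, ZMod.card])
  let P : ZMod (2 * c + 1) → Prop := fun d => d ≠ 0 ∧ d.val ≤ c
  have hP : ∀ d, d ≠ 0 → (P d ↔ ¬ P (-d)) := by
    intro d hd
    have : NeZero d := ⟨hd⟩
    have h₁ := ZMod.val_neg_of_ne_zero d
    have h₂ := ZMod.val_lt d
    simp only [P, neg_ne_zero, hd, ne_eq, not_false_eq_true, true_and, h₁]
    omega
  have hcount : (Finset.univ.filter P).card = c := by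
    have h₁ : (Finset.univ.filter P).card = (Finset.Icc 1 c).card := by
      refine Finset.card_bij (fun d _ => d.val) ?_ ?_ ?_
      · intro d hd
        have hd := (Finset.mem_filter.1 hd).2
        have := (ZMod.val_pos (a := d)).2 hd.1
        exact Finset.mem_Icc.2 ⟨this, hd.2⟩
      · intro d _ d' _ h
        exact ZMod.val_injective _ h
      · intro j hj
        obtain ⟨hj₁, hj₂⟩ := Finset.mem_Icc.1 hj
        have hv : ((j : ℕ) : ZMod (2 * c + 1)).val = j := ZMod.val_natCast_of_lt (by omega)
        refine ⟨(j : ZMod (2 * c + 1)), Finset.mem_filter.2 ⟨Finset.mem_univ _, ?_, ?_⟩, hv⟩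
        · exact (ZMod.val_pos).1 (by omega)
        · omega
    rw [h₁, Nat.card_Icc]
    omega
  obtain ⟨C, hC⟩ : ∃ C : Digraph V, ∀ u v, C.Adj u v ↔
      ∃ (hu : u ∈ B) (hv : v ∈ B), P (e ⟨v, hv⟩ - e ⟨u, hu⟩) := ⟨⟨_⟩, fun _ _ => Iff.rfl⟩
  have hC₁ : ∀ v, ¬ C.Adj v v := by
    intro v hv
    obtain ⟨_, _, h⟩ := (hC v v).1 hv
    exact h.1 (sub_self _)
  have hC₂ : ∀ u ∈ B, ∀ v ∈ B, u ≠ v → (C.Adj u v ↔ ¬ C.Adj v u) := by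
    intro u hu v hv huv
    have h₁ : e ⟨v, hv⟩ - e ⟨u, hu⟩ ≠ 0 := by
      rw [sub_ne_zero, e.injective.ne_iff]
      exact fun h => huv (congrArg Subtype.val h).symm
    have h₂ := hP _ h₁
    rw [neg_sub] at h₂
    simpa [hC, hu, hv] using h₂
  refine ⟨C, hC₁, hC₂, fun v hv => ?_⟩
  rw [outTo, ← hcount]
  refine Finset.card_bij' (fun w hw => e ⟨w, (Finset.mem_filter.1 hw).1⟩ - e ⟨v, hv⟩)
    (fun d _ => (e.symm (d + e ⟨v, hv⟩) : V)) ?_ ?_ ?_ ?_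
  · intro w hw
    obtain ⟨_, _, h⟩ := (hC v w).1 (Finset.mem_filter.1 hw).2
    exact Finset.mem_filter.2 ⟨Finset.mem_univ _, h⟩
  · intro d hd
    have hd := (Finset.mem_filter.1 hd).2
    refine Finset.mem_filter.2 ⟨Finset.coe_mem _, (hC _ _).2 ⟨hv, Finset.coe_mem _, ?_⟩⟩
    simpa using hd
  · intro w hw
    simp
  · intro d hd
    simp

end Completion

/-! ### Completing a nearly regular tournament -/

section Completion

/-- A tournament that is nearly regular on a set `A` of even size becomes regular on `A ∪ B`, where
`|B|` is odd, by a change of arcs incident to `B` only, as soon as `|B|` bounds the differences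
between out- and in-degrees in `A`. Each vertex of `A` is given the number of out-neighbours in `B`
that it lacks; these are spread evenly over `B`, on which the new tournament is regular. -/
theorem IsTournament.exists_regular_completion {V : Type*} [DecidableEq V] {D : Digraph V}
    (hD : D.IsTournament) {A B : Finset V} (hAB : Disjoint A B) {a c : ℕ} (hA : A.card = 2 * a)
    (hB : B.card = 2 * c + 1) (himb : ∀ u ∈ A, |∑ v ∈ A, D.arcSign u v| ≤ B.card) :
    ∃ R : Digraph V, R.IsTournament ∧ (∀ u v, u ∉ B → v ∉ B → (D.Adj u v ↔ R.Adj u v)) ∧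
      ∀ u ∈ A ∪ B, R.outTo u (A ∪ B) = a + c ∧ R.inFrom u (A ∪ B) = a + c := by
  classical
  have hdeg : ∀ u ∈ A, D.outTo u A ≤ a + c ∧ a + c - D.outTo u A ≤ B.card := by
    intro u hu
    have h₁ := hD.outTo_add_inFrom_of_mem hu
    have h₂ := abs_le.1 (himb u hu)
    rw [sum_arcSign] at h₂
    omega
  obtain ⟨N, hN, q, hq⟩ := exists_subsets_balanced A B (fun u => a + c - D.outTo u A)
    fun u hu => (hdeg u hu).2
  obtain ⟨C, hC₁, hC₂, hC₃⟩ := exists_regular_tournament B hB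
  set col : V → ℕ := fun u => (A.filter fun v => u ∈ N v).card with hcol
  have hsum : ∑ u ∈ B, col u = B.card * a := by
    have h₁ : ∑ u ∈ B, col u = ∑ v ∈ A, (a + c - D.outTo v A) := by
      simp only [hcol, Finset.card_filter]
      rw [Finset.sum_comm]
      refine Finset.sum_congr rfl fun v hv => ?_
      obtain ⟨hNB, hNc⟩ := hN v hv
      rw [← hNc, ← Finset.card_filter, Finset.filter_mem_eq_inter,
        Finset.inter_eq_right.2 hNB]
    have h₂ := hD.two_mul_sum_outTo A
    have h₃ : ∑ v ∈ A, (a + c - D.outTo v A) + ∑ v ∈ A, D.outTo v A = A.card * (a + c) := by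
      rw [← Finset.sum_add_distrib, ← smul_eq_mul, ← Finset.sum_const]
      exact Finset.sum_congr rfl fun v hv => Nat.sub_add_cancel (hdeg v hv).1
    rw [h₁]
    rw [hA] at h₂ h₃
    rw [hB]
    zify at h₃ ⊢
    push_cast at h₂
    linarith
  have hcola : ∀ u ∈ B, col u = a := by
    rcases le_or_gt a q with h | h
    · have h₁ : ∀ u ∈ B, a ≤ col u := fun u hu => h.trans (hq u hu).1
      have h₂ : ∑ _u ∈ B, a = ∑ u ∈ B, col u := by rw [hsum, Finset.sum_const, smul_eq_mul]
      exact fun u hu => ((Finset.sum_eq_sum_iff_of_le h₁).1 h₂ u hu).symm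
    · have h₁ : ∀ u ∈ B, col u ≤ a := fun u hu => (hq u hu).2.trans h
      have h₂ : ∑ u ∈ B, col u = ∑ _u ∈ B, a := by rw [hsum, Finset.sum_const, smul_eq_mul]
      exact fun u hu => (Finset.sum_eq_sum_iff_of_le h₁).1 h₂ u hu
  obtain ⟨R, hR⟩ : ∃ R : Digraph V, ∀ u v, R.Adj u v ↔
      if u ∈ B then
        if v ∈ B then C.Adj u v else if v ∈ A then u ∉ N v else D.Adj u v
      else if u ∈ A ∧ v ∈ B then v ∈ N u else D.Adj u v := ⟨⟨_⟩, fun _ _ => Iff.rfl⟩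
  have hAB' : ∀ u ∈ A, u ∉ B := fun u hu => Finset.disjoint_left.1 hAB hu
  have hRt : R.IsTournament := by
    refine isTournament_of_adj_iff (fun v => ?_) fun u v huv => ?_
    · rw [hR]
      by_cases hv : v ∈ B <;> simp [hv, hC₁, hD.1]
    · rw [hR, hR]
      have h₁ := hD.adj_iff huv
      have h₂ := hC₂ u
      by_cases hu : u ∈ B <;> by_cases hv : v ∈ B <;> by_cases hu' : u ∈ A <;>
        by_cases hv' : v ∈ A <;> simp only [hu, hv, hu', hv'] <;> simp_all
  refine ⟨R, hRt, fun u v hu hv => by simp [hR, hu, hv], ?_⟩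
  suffices hout : ∀ u ∈ A ∪ B, R.outTo u (A ∪ B) = a + c by
    intro u hu
    have h₁ := hRt.outTo_add_inFrom_of_mem hu
    rw [Finset.card_union_of_disjoint hAB] at h₁
    have h₂ := hout u hu
    omega
  intro u hu
  rw [outTo_union _ _ hAB]
  rcases Finset.mem_union.1 hu with hu | hu
  · have h₁ : R.outTo u A = D.outTo u A := by
      unfold outTo
      congr 1
      exact Finset.filter_congr fun v hv => by simp [hR, hAB' u hu, hAB' v hv]
    have h₂ : R.outTo u B = a + c - D.outTo u A := by
      rw [← (hN u hu).2, outTo]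
      congr 1
      ext v
      have := @(hN u hu).1 v
      simp only [Finset.mem_filter, hR, hAB' u hu, hu, if_false, true_and]
      constructor
      · rintro ⟨hv, h⟩
        simpa [hv] using h
      · intro h
        exact ⟨this h, by simpa [this h] using h⟩
    have := (hdeg u hu).1
    omega
  · have h₁ : R.outTo u A + col u = A.card := by
      have h₂ : A.filter (fun v => R.Adj u v) = A.filter fun v => ¬ u ∈ N v :=
        Finset.filter_congr fun v hv => by simp [hR, hu, hv, hAB' v hv]
      rw [outTo, h₂, add_comm]
      exact Finset.card_filter_add_card_filter_not _
    have h₂ : R.outTo u B = C.outTo u B := by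
      unfold outTo
      congr 1
      exact Finset.filter_congr fun v hv => by simp [hR, hu, hv]
    have h₃ := hC₃ u hu
    have h₄ := hcola u hu
    omega

/-- The arcs between `W` and its complement can be oriented such that each vertex outside `W` sends
at least `k` arcs to `W` and receives at least `k` arcs from `W`. -/
theorem IsTournament.exists_attach {V : Type*} {D : Digraph V} (hD : D.IsTournament)
    {W : Finset V} {k : ℕ} (hW : 2 * k ≤ W.card) :
    ∃ R : Digraph V, R.IsTournament ∧ (∀ u v, u ∈ W → v ∈ W → (D.Adj u v ↔ R.Adj u v)) ∧
      ∀ u ∉ W, k ≤ R.outTo u W ∧ k ≤ R.inFrom u W := by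
  classical
  obtain ⟨P, hPW, hP⟩ := Finset.exists_subset_card_eq (show k ≤ W.card by omega)
  obtain ⟨R, hR⟩ : ∃ R : Digraph V, ∀ u v, R.Adj u v ↔
      if u ∈ W then if v ∈ W then D.Adj u v else u ∉ P
      else if v ∈ W then v ∈ P else D.Adj u v := ⟨⟨_⟩, fun _ _ => Iff.rfl⟩
  have hRt : R.IsTournament := by
    refine isTournament_of_adj_iff (fun v => ?_) fun u v huv => ?_
    · rw [hR]
      by_cases hv : v ∈ W <;> simp [hv, hD.1]
    · rw [hR, hR]
      have h₁ := hD.adj_iff huv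
      by_cases hu : u ∈ W <;> by_cases hv : v ∈ W <;> simp only [hu, hv] <;> simp_all
  refine ⟨R, hRt, fun u v hu hv => by simp [hR, hu, hv], fun u hu => ?_⟩
  have h₁ : W.filter (fun v => R.Adj u v) = P := by
    ext v
    have := @hPW v
    simp only [Finset.mem_filter, hR, hu, if_false]
    constructor
    · rintro ⟨hv, h⟩
      simpa [hv] using h
    · intro h
      exact ⟨this h, by simpa [this h] using h⟩
  have h₂ : R.outTo u W = k := by rw [outTo, h₁, hP]
  have h₃ := hRt.outTo_add_inFrom_of_notMem hu
  omega

end Completion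

/-! ### Bounds on the number of inversions -/

section Bounds

variable {V : Type*} {D : Digraph V}

/-- The case of many vertices: a bounded number of inversions suffices. -/
theorem IsTournament.exists_arcStrong_of_large [Fintype V] (hD : D.IsTournament) {k : ℕ}
    (hk : 1000000 ≤ k) (hV : 5 * k ≤ 2 * Fintype.card V) :
    ∃ L : List (Set V), L.length = 20 ∧ (D.invertFamily L).IsArcStrong k := by
  classical
  obtain ⟨m, hm₁, hm₂⟩ : ∃ m, 5 * k ≤ 2 * m ∧ 2 * m ≤ 5 * k + 1 :=
    ⟨(5 * k + 1) / 2, by omega, by omega⟩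
  obtain ⟨W, -, hW⟩ := Finset.exists_subset_card_eq
    (show m ≤ (Finset.univ : Finset V).card by rw [Finset.card_univ]; omega)
  obtain ⟨x, G, hGW, hG, hbal, hcoll⟩ := exists_almost_balanced W (by omega) D.arcSign
    D.abs_arcSign_le D.arcSign_self
  rw [hW] at hG hbal hcoll
  have hcard : (W \ G).card + G.card = m := by
    rw [Finset.card_sdiff_add_card_eq_card hGW, hW]
  -- the vertices outside `G` get new vectors, which balance them against `G`
  choose y hy using fun u => exists_sq_sum_mul_walsh_le G (D.arcSign u) (D.abs_arcSign_le u) x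
  set z : V → Fin 20 → Bool := fun v => if v ∈ G then x v else y v with hz
  obtain ⟨L, hL, hsign⟩ := exists_invertFamily_arcSign D z
  refine ⟨L, hL, ?_⟩
  set E := D.invertFamily L with hE
  have hEt : E.IsTournament := hD.invertFamily L
  have hzG : ∀ u, ∑ v ∈ G, E.arcSign u v = ∑ v ∈ G, D.arcSign u v * walsh (z u) (x v) := by
    intro u
    refine Finset.sum_congr rfl fun v hv => ?_
    rw [hsign]
    simp [hz, hv]
  have hdeg : ∀ u, k ≤ E.outTo u G ∧ k ≤ E.inFrom u G := by
    intro u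
    have h₁ := E.sum_arcSign u G
    by_cases hu : u ∈ G
    · have h₂ := hEt.outTo_add_inFrom_of_mem hu
      obtain ⟨L', -, hsign'⟩ := exists_invertFamily_arcSign D x
      have h₃ := (D.invertFamily L').abs_sum_arcSign_le_of_subset u hGW
      have h₄ := hbal u hu
      simp only [hsign'] at h₃
      have h₅ : z u = x u := by simp [hz, hu]
      rw [hzG, h₅] at h₁
      rw [h₁] at h₃
      have h₆ := abs_le.1 h₃
      omega
    · have h₂ := hEt.outTo_add_inFrom_of_notMem hu
      have h₃ : z u = y u := by simp [hz, hu]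
      have h₄ := (hy u).trans (collisions_mono hGW x)
      rw [← h₃, ← hzG] at h₄
      have h₅ : (50 * ∑ v ∈ G, E.arcSign u v) ^ 2 ≤ (m : ℤ) ^ 2 := by nlinarith
      have h₆ := abs_le_of_sq_le_sq' h₅ (by positivity)
      omega
  exact hEt.isArcStrong_of_core (by omega) (fun v => (hdeg v).1) fun v => (hdeg v).2

/-- The case of few vertices: after a bounded number of inversions, a set `W` of `2k + 1` vertices
contains a nearly regular set `A` of all but a small fraction of its vertices. Then the arcs
incident to `W \ A` are changed such that `W` becomes regular, and the arcs between `W` and the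
other vertices such that these get enough arcs in both directions. -/
theorem IsTournament.exists_arcStrong_of_small [Fintype V] (hD : D.IsTournament) {k : ℕ}
    (hk : 1000000 ≤ k) (hV : 2 * k + 1 ≤ Fintype.card V) (hV' : 2 * Fintype.card V < 5 * k) :
    ∃ L : List (Set V), 3 * L.length ≤ 4 * k ∧ (D.invertFamily L).IsArcStrong k := by
  classical
  obtain ⟨W, -, hW⟩ := Finset.exists_subset_card_eq
    (show 2 * k + 1 ≤ (Finset.univ : Finset V).card by rwa [Finset.card_univ])
  -- `B₀` is so large that `|B|` exceeds the imbalances in `A`, which may grow by the number of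
  -- vertices of `A₀` that are left out
  obtain ⟨b, hb₁, hb₂⟩ : ∃ b, 2 * k + 100 ≤ 25 * b ∧ 25 * b ≤ 2 * k + 124 :=
    ⟨(2 * k + 124) / 25, by omega, by omega⟩
  obtain ⟨A₀, hA₀W, hA₀⟩ := Finset.exists_subset_card_eq (show 2 * k + 1 - b ≤ W.card by omega)
  obtain ⟨x, G, hGA, hG, hbal, -⟩ := exists_almost_balanced A₀ (by omega) D.arcSign
    D.abs_arcSign_le D.arcSign_self
  have hGcard : (A₀ \ G).card + G.card = A₀.card := Finset.card_sdiff_add_card_eq_card hGA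
  obtain ⟨a, ha₁, ha₂⟩ : ∃ a, 2 * a ≤ G.card ∧ G.card ≤ 2 * a + 1 :=
    ⟨G.card / 2, by omega, by omega⟩
  obtain ⟨A, hAG, hA⟩ := Finset.exists_subset_card_eq ha₁
  have hAA₀ := hAG.trans hGA
  have hAW := hAA₀.trans hA₀W
  have hAcard : (A₀ \ A).card + A.card = A₀.card := Finset.card_sdiff_add_card_eq_card hAA₀
  set B := W \ A with hBdef
  have hBcard : B.card + A.card = W.card := Finset.card_sdiff_add_card_eq_card hAW
  obtain ⟨L₁, hL₁, hsign⟩ := exists_invertFamily_arcSign D x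
  set E := D.invertFamily L₁ with hE
  have hEt : E.IsTournament := hD.invertFamily L₁
  have hABdisj : Disjoint A B := Finset.disjoint_sdiff
  have hABunion : A ∪ B = W := Finset.union_sdiff_of_subset hAW
  obtain ⟨R, hRt, hRE, hRdeg⟩ := hEt.exists_regular_completion hABdisj hA
    (show B.card = 2 * (k - a) + 1 by omega) (by
      intro u hu
      have h₁ := E.abs_sum_arcSign_le_of_subset u hAA₀
      have h₂ := hbal u (hAG hu)
      simp only [hsign] at h₁ ⊢
      omega)
  rw [hABunion] at hRdeg
  obtain ⟨R', hRt', hRR', hRdeg'⟩ := hRt.exists_attach (show 2 * k ≤ W.card by omega)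
  have hRW : ∀ u ∈ W, R'.outTo u W = R.outTo u W ∧ R'.inFrom u W = R.inFrom u W := by
    intro u hu
    constructor
    · unfold outTo
      congr 1
      exact Finset.filter_congr fun v hv => (hRR' u v hu hv).symm
    · unfold inFrom
      congr 1
      exact Finset.filter_congr fun v hv => (hRR' v u hv hu).symm
  have hdeg : ∀ u, k ≤ R'.outTo u W ∧ k ≤ R'.inFrom u W := by
    intro u
    by_cases hu : u ∈ W
    · have h₁ := hRdeg u hu
      have h₂ := hRW u hu
      omega
    · exact hRdeg' u hu
  have hstrong : R'.IsArcStrong k :=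
    hRt'.isArcStrong_of_core (by omega) (fun v => (hdeg v).1) fun v => (hdeg v).2
  obtain ⟨L₂, hL₂, hER⟩ := hEt.exists_invertFamily_eq hRt' Aᶜ (by
    intro u v hu hv
    simp only [Finset.mem_compl, not_not] at hu hv
    rw [hRE u v (Finset.disjoint_left.1 hABdisj hu) (Finset.disjoint_left.1 hABdisj hv),
      hRR' u v (hAW hu) (hAW hv)])
  refine ⟨L₁ ++ L₂, ?_, ?_⟩
  · rw [Finset.card_compl] at hL₂
    rw [List.length_append]
    omega
  · rw [invertFamily_append, ← hE, hER]
    exact hstrong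

end Bounds

end Digraph

theorem maxArcStrongInvNumber_le {k N : ℕ} (hk : 1000000 ≤ k) (hN : 4 * k ≤ 3 * N + 2) :
    maxArcStrongInvNumber k ≤ N := by
  refine iSup_le fun V => iSup_le fun _ => iSup_le fun T => iSup_le fun hT => iSup_le fun hV => ?_
  have := Fintype.ofFinite V
  rw [Nat.card_eq_fintype_card] at hV
  obtain ⟨L, hL, hLk⟩ : ∃ L : List (Set V), 3 * L.length ≤ 4 * k ∧
      (T.invertFamily L).IsArcStrong k := by
    rcases lt_or_ge (2 * Fintype.card V) (5 * k) with h | h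
    · exact hT.exists_arcStrong_of_small hk hV h
    · obtain ⟨L, hL, hLk⟩ := hT.exists_arcStrong_of_large hk h
      exact ⟨L, by omega, hLk⟩
  refine (iInf₂_le L hLk).trans ?_
  exact_mod_cast (by omega : L.length ≤ N)

/-- `M'_k ≤ (4/3) k + o(k)` as `k → ∞`; in particular `M'_k` is finite for all large `k`. -/
theorem mainTheorem7 :
    ∃ r : ℕ → ℝ, r =o[atTop] (fun k : ℕ => (k : ℝ)) ∧
      ∀ᶠ k : ℕ in atTop, maxArcStrongInvNumber k ≠ ⊤ ∧
        ((maxArcStrongInvNumber k).toNat : ℝ) ≤ (4 / 3 : ℝ) * (k : ℝ) + r k := by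
  -- the bound holds without an error term
  refine ⟨fun _ => 0, isLittleO_zero _ _, ?_⟩
  filter_upwards [eventually_ge_atTop 1000000] with k hk
  have h := maxArcStrongInvNumber_le (N := 4 * k / 3) hk (by omega)
  have h₁ : (maxArcStrongInvNumber k).toNat ≤ 4 * k / 3 := ENat.toNat_le_of_le_natCast h
  have h₂ : 3 * (maxArcStrongInvNumber k).toNat ≤ 4 * k := by omega
  have h₃ : (3 : ℝ) * (maxArcStrongInvNumber k).toNat ≤ 4 * k := by exact_mod_cast h₂
  exact ⟨ne_top_of_le_ne_top (ENat.natCast_ne_top _) h, by linarith⟩
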